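/- Let $A,B$ be finite-dimensional quantum systems of dimensions $d_A,d_B$. For a state (density matrix) $\rho_{AB}$ on $A\otimes B$ with marginals $\rho_A=\mathrm{tr}_B\rho_{AB}$, $\rho_B=\mathrm{tr}_A\rho_{AB}$, let $S(\rho)=-\mathrm{tr}(\rho\log\rho)$ be the von Neumann entropy and $I(\rho_{AB})=S(\rho_A)+S(\rho_B)-S(\rho_{AB})$ the mutual information. For an orthonormal eigenbasis $\{|i\rangle\}$ of $\rho_A$ put $\Pi_i=|i\rangle\langle i|$ and $\pi_A(\rho_{AB})=\sum_i(\Pi_i\otimes I_B)\rho_{AB}(\Pi_i\otimes I_B)$. The diagonal discord is $\bar D_A(\rho_{AB})=I(\rho_{AB})-\max_{\pi_A}I(\pi_A(\rho_{AB}))$, where the maximum is over all orthonormal eigenbases of $\rho_A$. Let $H(x)=-x\log x-(1-x)\log(1-x)$ be the binary entropy function and $\|\cdot\|_1$ the trace norm. **Theorem.** Let $\rho_{AB}$ be a state such that $\rho_A$ has distinct eigenvalues (i.e. is nondegenerate). Then $\bar D_A$, as a function on the set of states on $A\otimes B$, is continuous at $\rho_{AB}$. More explicitly, suppose $d_A\ge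 2$ and let $\Delta>0$ be the smallest gap between two distinct eigenvalues of $\rho_A$. Then there is $\epsilon_0>0$ such that for all $0<\epsilon\le\epsilon_0$ and all states $\rho'_{AB}$ with $\|\rho'_{AB}-\rho_{AB}\|_1\le\epsilon$, $$|\bar D_A(\rho'_{AB})-\bar D_A(\rho_{AB})|\le\left(\frac{\sqrt{2\,d_A^3d_B^3}}{\Delta}+1\right)\epsilon\log(d_Ad_B-1)+H\!\left[\frac12\left(\frac{2\sqrt{2\,d_A^3d_B^3}}{\Delta}+1\right)\epsilon\right]+H(\epsilon/2).$$ -/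

import Mathlib

open scoped Kronecker ComplexOrder

noncomputable section

namespace DiagonalDiscord

variable {A B n : Type*} [Fintype A] [DecidableEq A] [Fintype B] [DecidableEq B]
  [Fintype n] [DecidableEq n]

/-- A quantum state (density matrix): a positive semidefinite matrix of trace one. -/
def IsState (ρ : Matrix n n ℂ) : Prop :=
  ρ.PosSemidef ∧ ρ.trace = 1

/-- The trace norm `‖M‖₁ = tr √(Mᴴ M)`, i.e. the sum of the singular values of `M`. -/
def traceNorm (M : Matrix n n ℂ) : ℝ :=
  ∑ i, √((Matrix.isHermitian_conjTranspose_mul_self M).eigenvalues i)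

open Classical in
/-- The von Neumann entropy `S(ρ) = - tr (ρ log ρ) = - ∑ᵢ λᵢ log λᵢ`, where the `λᵢ` are the
eigenvalues of the Hermitian matrix `ρ`, with multiplicity, and `0 log 0 = 0`.
(The value `0` at non-Hermitian matrices is never used.) -/
def entropy (ρ : Matrix n n ℂ) : ℝ :=
  if h : ρ.IsHermitian then -∑ i, h.eigenvalues i * Real.log (h.eigenvalues i) else 0

/-- The reduced matrix `ρ_A = tr_B ρ_AB`. -/
def reduceA (ρ : Matrix (A × B) (A × B) ℂ) : Matrix A A ℂ :=
  Matrix.of fun a a' => ∑ b, ρ (a, b) (a', b)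

/-- The reduced matrix `ρ_B = tr_A ρ_AB`. -/
def reduceB (ρ : Matrix (A × B) (A × B) ℂ) : Matrix B B ℂ :=
  Matrix.of fun b b' => ∑ a, ρ (a, b) (a, b')

/-- The quantum mutual information `I(ρ_AB) = S(ρ_A) + S(ρ_B) - S(ρ_AB)`. -/
def mutualInformation (ρ : Matrix (A × B) (A × B) ℂ) : ℝ :=
  entropy (reduceA ρ) + entropy (reduceB ρ) - entropy ρ

/-- The projector `|i⟩⟨i|` onto the `i`-th vector of an orthonormal basis. -/
def proj (e : OrthonormalBasis A ℂ (EuclideanSpace ℂ A)) (i : A) : Matrix A A ℂ :=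
  Matrix.vecMulVec (e i).ofLp (star (e i).ofLp)

/-- The orthonormal eigenbases of a Hermitian matrix `M`: those orthonormal bases for which
`M = ∑ᵢ pᵢ |i⟩⟨i|` with real `pᵢ`. -/
def eigenbases (M : Matrix A A ℂ) : Set (OrthonormalBasis A ℂ (EuclideanSpace ℂ A)) :=
  {e | ∃ p : A → ℝ, M = ∑ i, (p i : ℂ) • proj e i}

/-- The local measurement on `A` in an orthonormal basis:
`ρ ↦ ∑ᵢ (|i⟩⟨i| ⊗ I_B) ρ (|i⟩⟨i| ⊗ I_B)`. -/
def measureA (e : OrthonormalBasis A ℂ (EuclideanSpace ℂ A))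
    (ρ : Matrix (A × B) (A × B) ℂ) : Matrix (A × B) (A × B) ℂ :=
  ∑ i, (proj e i ⊗ₖ (1 : Matrix B B ℂ)) * ρ * (proj e i ⊗ₖ (1 : Matrix B B ℂ))

/-- The diagonal discord `I(ρ_AB) - max I(π_A(ρ_AB))` measured by `A`, where the maximum is over
the local measurements `π_A` in an orthonormal eigenbasis of `ρ_A`. For a state the values over
which the supremum is taken are nonempty and bounded (the dimension being finite). -/
def diagonalDiscord (ρ : Matrix (A × B) (A × B) ℂ) : ℝ :=
  mutualInformation ρ -
    sSup ((fun e => mutualInformation (measureA e ρ)) '' eigenbases (reduceA ρ))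

set_option linter.unusedSectionVars false in
theorem IsState.isHermitian_reduceA {ρ : Matrix (A × B) (A × B) ℂ} (hρ : IsState ρ) :
    (reduceA ρ).IsHermitian := by
  ext a a'
  simp only [reduceA, Matrix.conjTranspose_apply, Matrix.of_apply, star_sum]
  exact Finset.sum_congr rfl fun b _ => hρ.1.isHermitian.apply (a, b) (a', b)

/-- The eigenvalues of the reduced state `ρ_A`, listed with multiplicity. -/
def localSpectrum {ρ : Matrix (A × B) (A × B) ℂ} (hρ : IsState ρ) : A → ℝ :=
  hρ.isHermitian_reduceA.eigenvalues

end DiagonalDiscord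

end

/-!
# Continuity of the diagonal discord at states with nondegenerate marginal

Measuring `A` in an eigenbasis of `ρ_A` changes neither marginal
(`mutualInformation_measureA`), so the diagonal discord is the smallest increase
`S(π(ρ)) - S(ρ)` of the global entropy over these measurements `π`. Both entropies are controlled
by the Fannes–Audenaert inequality
`|S(ρ) - S(σ)| ≤ T log (d - 1) + H(T)`, `T = ‖ρ - σ‖₁ / 2` (`abs_entropy_sub_le`), and it remains
to compare `π'(ρ')` with `π(ρ)` in trace norm. Since `π'` is a trace norm contraction,
`‖π'(ρ') - π(ρ)‖₁ ≤ ‖ρ' - ρ‖₁ + ‖π'(ρ) - π(ρ)‖₁`, and the last term is of order `ε / Δ` because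
the eigenprojections of `ρ'_A` are close to those of `ρ_A`. This holds for all pairs of eigenbases
at once, degenerate spectrum of `ρ'_A` included, so no selection of an optimal basis is needed.

Trace norm bounds are handled through certificates: `‖M‖₁ ≤ c` for Hermitian `M` means that
`M = P - N` with `P, N ≥ 0` and `tr P + tr N ≤ c` (`HasTraceNormBound`). In this form
the triangle inequality and the contractivity under partial trace and measurement are immediate.

* The Fannes–Audenaert inequality is reduced to the classical one by Mirsky's inequality
  (`HasTraceNormBound.sum_abs_eigenvalues_sub_le`), which follows from Weyl's monotonicity
  principle (`eigenvalues_le_eigenvalues`). The classical inequality is Fano's inequality for the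
  maximal coupling of two distributions (`sum_negMulLog_sub_le`).
* The perturbation of the measurement rests on the identity
  `∑ⱼᵢ (pⱼ - p'ᵢ)² tr (Pⱼ P'ᵢ) = ‖ρ'_A - ρ_A‖²` in the Frobenius norm
  (`trace_sub_sq_eq_sum_overlap`): the matrix of overlaps `tr (Pⱼ P'ᵢ)` is doubly stochastic and
  concentrates on pairs of close eigenvalues, so the gap `Δ` forces it to be close to a permutation
  matrix (`exists_perm_sum_one_sub_le`). The operator inequality in
  `hasTraceNormBound_conj_sub_conj` turns this into the bound `6 ε / Δ` on `‖π'(ρ) - π(ρ)‖₁`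
  (`hasTraceNormBound_measureA_sub_measureA`), which is smaller than the constant in the theorem as
  soon as `d_A ≥ 2`.
-/

namespace DiagonalDiscord

/-! ### Rank-one projections of an orthonormal basis and spectral decompositions -/

section Projections

set_option linter.unusedSectionVars false

variable {n : Type*} [Fintype n] [DecidableEq n]

theorem proj_posSemidef (e : OrthonormalBasis n ℂ (EuclideanSpace ℂ n)) (i : n) :
    (proj e i).PosSemidef :=
  Matrix.posSemidef_vecMulVec_self_star _

theorem conjTranspose_proj (e : OrthonormalBasis n ℂ (EuclideanSpace ℂ n)) (i : n) :
    (proj e i).conjTranspose = proj e i :=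
  (proj_posSemidef e i).isHermitian

theorem star_dotProduct_basis (e : OrthonormalBasis n ℂ (EuclideanSpace ℂ n)) (i j : n) :
    star (e i).ofLp ⬝ᵥ (e j).ofLp = if i = j then 1 else 0 := by
  rw [dotProduct_comm, ← EuclideanSpace.inner_eq_star_dotProduct]
  exact e.inner_eq_ite i j

theorem proj_mul_proj (e : OrthonormalBasis n ℂ (EuclideanSpace ℂ n)) (i j : n) :
    proj e i * proj e j = if i = j then proj e i else 0 := by
  rw [proj, proj, Matrix.vecMulVec_mul_vecMulVec, star_dotProduct_basis]
  split_ifs with h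
  · simp [h]
  · simp

theorem trace_proj (e : OrthonormalBasis n ℂ (EuclideanSpace ℂ n)) (i : n) :
    (proj e i).trace = 1 := by
  rw [proj, Matrix.trace_vecMulVec, dotProduct_comm, star_dotProduct_basis, if_pos rfl]

theorem sum_proj (e : OrthonormalBasis n ℂ (EuclideanSpace ℂ n)) : ∑ i, proj e i = 1 := by
  ext a b
  have h := e.sum_inner_mul_inner (EuclideanSpace.single a (1 : ℂ)) (EuclideanSpace.single b 1)
  rw [Matrix.sum_apply, Matrix.one_apply]
  simpa [proj, Matrix.vecMulVec_apply, EuclideanSpace.inner_single_left,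
    EuclideanSpace.inner_single_right, Pi.single_apply, eq_comm] using h

/-- The spectral theorem, as a combination of rank-one projections. -/
theorem eq_sum_eigenvalues_smul_proj {M : Matrix n n ℂ} (h : M.IsHermitian) :
    M = ∑ i, (h.eigenvalues i : ℂ) • proj h.eigenvectorBasis i := by
  conv_lhs => rw [← mul_one M, ← sum_proj h.eigenvectorBasis, Finset.mul_sum]
  refine Finset.sum_congr rfl fun i _ => ?_
  rw [proj, Matrix.mul_vecMulVec, h.mulVec_eigenvectorBasis]
  ext a b
  simp [Matrix.vecMulVec_apply, mul_assoc]

theorem trace_sum_smul_proj (e : OrthonormalBasis n ℂ (EuclideanSpace ℂ n)) (p : n → ℝ) :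
    (∑ i, (p i : ℂ) • proj e i).trace.re = ∑ i, p i := by
  simp [Matrix.trace_sum, Matrix.trace_smul, trace_proj]

theorem posSemidef_sum_smul_proj (e : OrthonormalBasis n ℂ (EuclideanSpace ℂ n)) {p : n → ℝ}
    (hp : ∀ i, 0 ≤ p i) : (∑ i, (p i : ℂ) • proj e i).PosSemidef :=
  Matrix.posSemidef_sum _ fun i _ =>
    (proj_posSemidef e i).smul (Complex.zero_le_real.mpr (hp i))

theorem sum_smul_proj_mul (e : OrthonormalBasis n ℂ (EuclideanSpace ℂ n)) (p q : n → ℝ) :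
    (∑ i, (p i : ℂ) • proj e i) * (∑ i, (q i : ℂ) • proj e i) =
      ∑ i, ((p i * q i : ℝ) : ℂ) • proj e i := by
  rw [Finset.sum_mul]
  refine Finset.sum_congr rfl fun i _ => ?_
  ext a b
  simp [Finset.mul_sum, proj_mul_proj, mul_assoc, mul_left_comm]

/-- The coefficients in a spectral decomposition are the eigenvalues, up to their order: both
families are the roots of the characteristic polynomial. -/
theorem map_eq_map_eigenvalues {M : Matrix n n ℂ} (h : M.IsHermitian)
    (e : OrthonormalBasis n ℂ (EuclideanSpace ℂ n)) (p : n → ℝ)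
    (hM : M = ∑ i, (p i : ℂ) • proj e i) :
    Finset.univ.val.map p = Finset.univ.val.map h.eigenvalues := by
  set U : Matrix n n ℂ := Matrix.of fun a i => e i a with hU
  have hUU : U.conjTranspose * U = 1 := by
    ext i j
    rw [Matrix.one_apply, ← star_dotProduct_basis e i j]
    simp [Matrix.mul_apply, hU, dotProduct]
  have hMU : M = U * (Matrix.diagonal (fun i => (p i : ℂ)) * U.conjTranspose) := by
    rw [hM]
    ext a b
    simp [Matrix.sum_apply, proj, Matrix.vecMulVec_apply, Matrix.mul_apply, hU,
      Matrix.diagonal_apply]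
    refine Finset.sum_congr rfl fun i _ => ?_
    ring
  have hchar : M.charpoly = ∏ i, (Polynomial.X - Polynomial.C (p i : ℂ)) := by
    rw [hMU, Matrix.charpoly_mul_comm, mul_assoc, hUU, mul_one, Matrix.charpoly_diagonal]
  have hroots := h.roots_charpoly_eq_eigenvalues
  rw [hchar, Polynomial.roots_prod _ _ (Finset.prod_ne_zero_iff.mpr fun i _ =>
    Polynomial.X_sub_C_ne_zero _)] at hroots
  simp only [Polynomial.roots_X_sub_C, Multiset.bind_singleton] at hroots
  have hre := congrArg (Multiset.map Complex.re) hroots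
  simpa [Multiset.map_map] using hre

theorem trace_re_nonneg {X : Matrix n n ℂ} (hX : X.PosSemidef) : 0 ≤ X.trace.re :=
  (Complex.le_def.mp hX.trace_nonneg).1

theorem trace_proj_mul_re_nonneg (e : OrthonormalBasis n ℂ (EuclideanSpace ℂ n)) (i : n)
    {Y : Matrix n n ℂ} (hY : Y.PosSemidef) : 0 ≤ (proj e i * Y).trace.re := by
  have h : (proj e i * Y).trace = (proj e i * Y * (proj e i).conjTranspose).trace := by
    rw [Matrix.trace_mul_comm (proj e i * Y), conjTranspose_proj, ← mul_assoc, proj_mul_proj,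
      if_pos rfl]
  rw [h]
  exact trace_re_nonneg (hY.mul_mul_conjTranspose_same _)

theorem sum_trace_proj_mul (e : OrthonormalBasis n ℂ (EuclideanSpace ℂ n)) (X : Matrix n n ℂ) :
    ∑ i, (proj e i * X).trace.re = X.trace.re := by
  rw [← Complex.re_sum, ← Matrix.trace_sum, ← Finset.sum_mul, sum_proj, one_mul]

theorem trace_mul_re_eq_sum {X : Matrix n n ℂ} (hX : X.IsHermitian) (Y : Matrix n n ℂ) :
    (X * Y).trace.re =
      ∑ i, hX.eigenvalues i * (proj hX.eigenvectorBasis i * Y).trace.re := by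
  conv_lhs => rw [eq_sum_eigenvalues_smul_proj hX, Finset.sum_mul, Matrix.trace_sum,
    Complex.re_sum]
  simp [Matrix.trace_smul]

theorem trace_mul_re_nonneg {X Y : Matrix n n ℂ} (hX : X.PosSemidef) (hY : Y.PosSemidef) :
    0 ≤ (X * Y).trace.re := by
  rw [trace_mul_re_eq_sum hX.isHermitian]
  exact Finset.sum_nonneg fun i _ =>
    mul_nonneg (hX.eigenvalues_nonneg i) (trace_proj_mul_re_nonneg _ i hY)

theorem trace_re_eq_sum_eigenvalues {X : Matrix n n ℂ} (hX : X.IsHermitian) :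
    X.trace.re = ∑ i, hX.eigenvalues i := by
  simp [hX.trace_eq_sum_eigenvalues]

theorem trace_mul_re_le {X Y : Matrix n n ℂ} (hX : X.PosSemidef) (hY : Y.PosSemidef) :
    (X * Y).trace.re ≤ X.trace.re * Y.trace.re := by
  rw [trace_mul_re_eq_sum hX.isHermitian, trace_re_eq_sum_eigenvalues hX.isHermitian,
    Finset.sum_mul]
  refine Finset.sum_le_sum fun i _ =>
    mul_le_mul_of_nonneg_left ?_ (hX.eigenvalues_nonneg i)
  rw [← sum_trace_proj_mul hX.isHermitian.eigenvectorBasis Y]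
  exact Finset.single_le_sum
    (f := fun j => (proj hX.isHermitian.eigenvectorBasis j * Y).trace.re)
    (fun j _ => trace_proj_mul_re_nonneg _ j hY) (Finset.mem_univ i)

end Projections

/-! ### The trace norm of Hermitian matrices -/

section TraceNormBounds

variable {n : Type*} [Fintype n] [DecidableEq n]

set_option linter.unusedSectionVars false

/-- `M` is Hermitian with trace norm at most `c`, in the form of a certificate: `M` is a difference
of two positive semidefinite matrices whose traces add up to at most `c`. -/
def HasTraceNormBound (M : Matrix n n ℂ) (c : ℝ) : Prop :=
  ∃ P N : Matrix n n ℂ, P.PosSemidef ∧ N.PosSemidef ∧ M = P - N ∧ P.trace.re + N.trace.re ≤ c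

theorem HasTraceNormBound.mono {M : Matrix n n ℂ} {c c' : ℝ} (h : HasTraceNormBound M c)
    (hc : c ≤ c') : HasTraceNormBound M c' := by
  obtain ⟨P, N, hP, hN, hM, h⟩ := h
  exact ⟨P, N, hP, hN, hM, h.trans hc⟩

theorem HasTraceNormBound.add {M M' : Matrix n n ℂ} {c c' : ℝ} (h : HasTraceNormBound M c)
    (h' : HasTraceNormBound M' c') : HasTraceNormBound (M + M') (c + c') := by
  obtain ⟨P, N, hP, hN, rfl, h⟩ := h
  obtain ⟨P', N', hP', hN', rfl, h'⟩ := h'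
  refine ⟨P + P', N + N', hP.add hP', hN.add hN', by abel, ?_⟩
  simp only [Matrix.trace_add, Complex.add_re]
  linarith

/-- If `-Q ≤ M ≤ Q`, then `‖M‖₁ ≤ tr Q`. -/
theorem hasTraceNormBound_of_le {M Q : Matrix n n ℂ} (h₁ : (Q + M).PosSemidef)
    (h₂ : (Q - M).PosSemidef) : HasTraceNormBound M Q.trace.re := by
  have h2 : (0 : ℂ) ≤ 2⁻¹ := by
    rw [show (2⁻¹ : ℂ) = ((2⁻¹ : ℝ) : ℂ) by simp]
    exact Complex.zero_le_real.mpr (by norm_num)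
  refine ⟨(2⁻¹ : ℂ) • (Q + M), (2⁻¹ : ℂ) • (Q - M), h₁.smul h2, h₂.smul h2, ?_, le_of_eq ?_⟩
  · rw [← smul_sub, show Q + M - (Q - M) = (2 : ℂ) • M by rw [two_smul]; abel, smul_smul]
    norm_num
  · rw [← Complex.add_re, ← Matrix.trace_add, ← smul_add,
      show Q + M + (Q - M) = (2 : ℂ) • Q by rw [two_smul]; abel, smul_smul]
    norm_num

/-- The spectral decomposition of `M` splits it into a positive and a negative part. Their traces
add up to `∑ |λᵢ|`, which is the trace norm because `Mᴴ M` has the eigenvalues `λᵢ²`. -/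
theorem hasTraceNormBound_traceNorm {M : Matrix n n ℂ} (hM : M.IsHermitian) :
    HasTraceNormBound M (traceNorm M) := by
  have hdec := eq_sum_eigenvalues_smul_proj hM
  set e := hM.eigenvectorBasis
  set p := hM.eigenvalues
  refine ⟨∑ i, ((max (p i) 0 : ℝ) : ℂ) • proj e i, ∑ i, ((max (-p i) 0 : ℝ) : ℂ) • proj e i,
    posSemidef_sum_smul_proj e fun i => le_max_right _ _,
    posSemidef_sum_smul_proj e fun i => le_max_right _ _, ?_, le_of_eq ?_⟩
  · conv_lhs => rw [hdec]
    rw [← Finset.sum_sub_distrib]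
    refine Finset.sum_congr rfl fun i _ => ?_
    rw [← sub_smul, ← Complex.ofReal_sub]
    congr 2
    rcases le_total 0 (p i) with h | h
    · rw [max_eq_left h, max_eq_right (by linarith), sub_zero]
    · rw [max_eq_right h, max_eq_left (by linarith), zero_sub, neg_neg]
  · rw [trace_sum_smul_proj, trace_sum_smul_proj, ← Finset.sum_add_distrib, traceNorm]
    have hsq : M.conjTranspose * M = ∑ i, ((p i * p i : ℝ) : ℂ) • proj e i := by
      rw [hM.eq, ← sum_smul_proj_mul e p p, ← hdec]
    have hmap := map_eq_map_eigenvalues (Matrix.isHermitian_conjTranspose_mul_self M) e _ hsq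
    have hsum := congrArg (fun s => (Multiset.map Real.sqrt s).sum) hmap
    simp only [Multiset.map_map, Function.comp_def, Real.sqrt_mul_self_eq_abs] at hsum
    refine Eq.trans (Finset.sum_congr rfl fun i _ => ?_) hsum
    rcases le_total 0 (p i) with h | h
    · rw [max_eq_left h, max_eq_right (by linarith), abs_of_nonneg h, add_zero]
    · rw [max_eq_right h, max_eq_left (by linarith), abs_of_nonpos h, zero_add]

/-- The Frobenius norm is at most the trace norm. -/
theorem HasTraceNormBound.trace_sq_le {M : Matrix n n ℂ} {c : ℝ} (h : HasTraceNormBound M c) :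
    (M * M).trace.re ≤ c ^ 2 := by
  obtain ⟨P, N, hP, hN, rfl, hc⟩ := h
  have h1 := trace_mul_re_le hP hP
  have h2 := trace_mul_re_le hN hN
  have h3 := trace_mul_re_nonneg hP hN
  have h4 := trace_mul_re_nonneg hN hP
  have h5 := trace_re_nonneg hP
  have h6 := trace_re_nonneg hN
  simp only [sub_mul, mul_sub, Matrix.trace_sub, Complex.sub_re]
  nlinarith [mul_nonneg h5 h6]

/-- The square of the trace norm is at most the dimension times the square of the Frobenius
norm. -/
theorem traceNorm_sq_le (M : Matrix n n ℂ) :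
    traceNorm M ^ 2 ≤ Fintype.card n * (M.conjTranspose * M).trace.re := by
  have h := Matrix.isHermitian_conjTranspose_mul_self M
  have hps := Matrix.posSemidef_conjTranspose_mul_self M
  rw [trace_re_eq_sum_eigenvalues h, traceNorm]
  refine (sq_sum_le_card_mul_sum_sq (s := Finset.univ)).trans (le_of_eq ?_)
  rw [Finset.card_univ]
  congr 1
  exact Finset.sum_congr rfl fun i _ => Real.sq_sqrt (hps.eigenvalues_nonneg i)

end TraceNormBounds

/-! ### Perturbation of eigenvalues: Weyl and Mirsky -/

section EigenvaluePerturbation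

variable {n : Type*} [Fintype n] [DecidableEq n]

/-- **Weyl's monotonicity principle**. In dimension `d` the `d - 1` linear conditions of being
orthogonal to the later eigenvectors of `X` and to the earlier eigenvectors of `Y` have a common
nonzero solution, at which the two quadratic forms are compared. -/
theorem eigenvalues_le_eigenvalues {X Y : Matrix n n ℂ} (hX : X.IsHermitian) (hY : Y.IsHermitian)
    (hXY : (Y - X).PosSemidef) (i : n) : hX.eigenvalues i ≤ hY.eigenvalues i := by
  -- `ord` is the position of an index in the decreasing order of the eigenvalues
  set ord : n ≃ Fin (Fintype.card n) := (Fintype.equivOfCardEq (Fintype.card_fin _)).symm with hord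
  have hanX : ∀ j k, ord j ≤ ord k → hX.eigenvalues k ≤ hX.eigenvalues j := fun j k h =>
    hX.eigenvalues₀_antitone h
  have hanY : ∀ j k, ord j ≤ ord k → hY.eigenvalues k ≤ hY.eigenvalues j := fun j k h =>
    hY.eigenvalues₀_antitone h
  let v : {j // j ≠ i} → (n → ℂ) := fun j =>
    if ord i < ord j then (hX.eigenvectorBasis j).ofLp else (hY.eigenvectorBasis j).ofLp
  let L : (n → ℂ) →ₗ[ℂ] ({j // j ≠ i} → ℂ) :=
    Matrix.mulVecLin (Matrix.of fun j => star (v j))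
  have hker : LinearMap.ker L ≠ ⊥ := by
    refine LinearMap.ker_ne_bot_of_finrank_lt ?_
    rw [Module.finrank_fintype_fun_eq_card, Module.finrank_fintype_fun_eq_card]
    exact Fintype.card_subtype_lt (x := i) (by simp)
  obtain ⟨x, hx, hx0⟩ := Submodule.exists_mem_ne_zero_of_ne_bot hker
  have hv : ∀ j, star (v j) ⬝ᵥ x = 0 := fun j => congrFun (LinearMap.mem_ker.mp hx) j
  set Z := Matrix.vecMulVec x (star x) with hZdef
  have hZ : Z.PosSemidef := Matrix.posSemidef_vecMulVec_self_star x
  have htr : 0 < Z.trace.re := by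
    refine lt_of_le_of_ne (trace_re_nonneg hZ) fun h0 => hx0 ?_
    have : Z.trace = 0 := Complex.ext h0.symm (Complex.le_def.mp hZ.trace_nonneg).2.symm
    rwa [hZdef, Matrix.trace_vecMulVec, dotProduct_comm, dotProduct_star_self_eq_zero] at this
  have hzero : ∀ (e : OrthonormalBasis n ℂ (EuclideanSpace ℂ n)) (j : n),
      star (e j).ofLp ⬝ᵥ x = 0 → (proj e j * Z).trace.re = 0 := by
    intro e j h
    rw [proj, hZdef, Matrix.vecMulVec_mul_vecMulVec, h]
    simp
  have h1 : hX.eigenvalues i * Z.trace.re ≤ (X * Z).trace.re := by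
    rw [trace_mul_re_eq_sum hX, ← sum_trace_proj_mul hX.eigenvectorBasis Z, Finset.mul_sum]
    refine Finset.sum_le_sum fun j _ => ?_
    by_cases hj : ord i < ord j
    · have hne : j ≠ i := fun h => by simp [h] at hj
      have := hv ⟨j, hne⟩
      simp only [v, if_pos hj] at this
      rw [hzero _ _ this, mul_zero, mul_zero]
    · exact mul_le_mul_of_nonneg_right (hanX _ _ (not_lt.mp hj))
        (trace_proj_mul_re_nonneg _ _ hZ)
  have h2 : (Y * Z).trace.re ≤ hY.eigenvalues i * Z.trace.re := by
    rw [trace_mul_re_eq_sum hY, ← sum_trace_proj_mul hY.eigenvectorBasis Z, Finset.mul_sum]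
    refine Finset.sum_le_sum fun j _ => ?_
    by_cases hj : ord j < ord i
    · have hne : j ≠ i := fun h => by simp [h] at hj
      have := hv ⟨j, hne⟩
      simp only [v, if_neg (not_lt.mpr hj.le)] at this
      rw [hzero _ _ this, mul_zero, mul_zero]
    · exact mul_le_mul_of_nonneg_right (hanY _ _ (not_lt.mp hj))
        (trace_proj_mul_re_nonneg _ _ hZ)
  have h3 := trace_mul_re_nonneg hXY hZ
  rw [sub_mul, Matrix.trace_sub, Complex.sub_re] at h3
  exact le_of_mul_le_mul_right (by linarith) htr

/-- **Mirsky's inequality** for the trace norm: with `X - Y = P - N`, the matrix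
`X + N = Y + P` dominates both `X` and `Y`, and so do its eigenvalues. -/
theorem HasTraceNormBound.sum_abs_eigenvalues_sub_le {X Y : Matrix n n ℂ} (hX : X.IsHermitian)
    (hY : Y.IsHermitian) {c : ℝ} (h : HasTraceNormBound (X - Y) c) :
    ∑ i, |hX.eigenvalues i - hY.eigenvalues i| ≤ c := by
  obtain ⟨P, N, hP, hN, hXY, hc⟩ := h
  have hZ : (X + N).IsHermitian := hX.add hN.isHermitian
  have h1 := eigenvalues_le_eigenvalues hX hZ (by simpa using hN)
  have h2 := eigenvalues_le_eigenvalues hY hZ (by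
    rw [show X + N - Y = X - Y + N by abel, hXY]; simpa using hP)
  calc ∑ i, |hX.eigenvalues i - hY.eigenvalues i|
      ≤ ∑ i, (hZ.eigenvalues i - hX.eigenvalues i + (hZ.eigenvalues i - hY.eigenvalues i)) :=
        Finset.sum_le_sum fun i _ => abs_le.mpr ⟨by linarith [h1 i, h2 i], by linarith [h1 i, h2 i]⟩
    _ = (X + N).trace.re - X.trace.re + ((X + N).trace.re - Y.trace.re) := by
        rw [trace_re_eq_sum_eigenvalues hX, trace_re_eq_sum_eigenvalues hY,
          trace_re_eq_sum_eigenvalues hZ]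
        simp only [Finset.sum_add_distrib, Finset.sum_sub_distrib]
    _ = P.trace.re + N.trace.re := by
        have := congrArg (fun M => M.trace.re) hXY
        simp only [Matrix.trace_sub, Complex.sub_re] at this
        simp only [Matrix.trace_add, Complex.add_re]
        linarith
    _ ≤ c := hc

end EigenvaluePerturbation

/-! ### The Fannes–Audenaert inequality -/

section EntropyContinuity

variable {n : Type*} [Fintype n] [DecidableEq n]

/-- The bound `T log (d - 1) + H(T)` increases on `[0, 1/2]` in every dimension `d ≥ 1`; at `d = 1`
the logarithm is `log 0 = 0`. -/
theorem qaryEntropy_le_qaryEntropy {d : ℕ} (hd : 1 ≤ d) {s t : ℝ} (hs : 0 ≤ s) (hst : s ≤ t)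
    (ht : t ≤ 1 / 2) : Real.qaryEntropy d s ≤ Real.qaryEntropy d t := by
  have hlog : 0 ≤ Real.log ((d - 1 : ℤ) : ℝ) := by
    rcases hd.eq_or_lt with h | h
    · simp [← h]
    · exact Real.log_nonneg (by exact_mod_cast (by omega : (1 : ℤ) ≤ d - 1))
  refine add_le_add (mul_le_mul_of_nonneg_right hst hlog)
    (Real.binEntropy_strictMonoOn.monotoneOn ⟨hs, ?_⟩ ⟨hs.trans hst, ?_⟩ hst)
  · linarith
  · linarith

/-- Gibbs' inequality, pointwise: the entropy of a weight against a reference weight. -/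
theorem negMulLog_le_sub {w r : ℝ} (hw : 0 ≤ w) (hr : 0 ≤ r) (h0 : r = 0 → w = 0) :
    Real.negMulLog w ≤ -w * Real.log r + (r - w) := by
  rcases hw.eq_or_lt with h | h
  · simp [← h, hr]
  have hr' : 0 < r := lt_of_le_of_ne hr fun h' => h.ne' (h0 h'.symm)
  have := Real.log_le_sub_one_of_pos (div_pos hr' h)
  rw [Real.log_div hr'.ne' h.ne'] at this
  have h2 := mul_le_mul_of_nonneg_left this h.le
  rw [mul_sub, mul_sub, mul_div_cancel₀ _ h.ne'] at h2
  rw [Real.negMulLog]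
  linarith

/-- One direction of the classical Fannes–Audenaert inequality: Fano's inequality for the
maximal coupling `w` of the two distributions, which charges the off-diagonal pairs with the total
variation distance `T`; the reference kernel is `1 - T` on the diagonal and `T / (d - 1)` off it. -/
theorem sum_negMulLog_sub_le {p q : n → ℝ} (hp : ∀ i, 0 ≤ p i) (hq : ∀ i, 0 ≤ q i)
    (hp1 : ∑ i, p i = 1) (hq1 : ∑ i, q i = 1) {T : ℝ} (hT : ∑ i, |p i - q i| = 2 * T)
    (hT0 : 0 < T) (hT1 : T < 1) :
    ∑ i, Real.negMulLog (p i) - ∑ i, Real.negMulLog (q i) ≤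
      Real.qaryEntropy (Fintype.card n) T := by
  set a : n → ℝ := fun i => p i - min (p i) (q i) with ha
  set b : n → ℝ := fun i => q i - min (p i) (q i) with hb
  have ha0 : ∀ i, 0 ≤ a i := fun i => sub_nonneg.mpr (min_le_left _ _)
  have hb0 : ∀ i, 0 ≤ b i := fun i => sub_nonneg.mpr (min_le_right _ _)
  have hab : ∀ i, a i * b i = 0 := by
    intro i
    rcases le_total (p i) (q i) with h | h <;> simp [ha, hb, h]
  have habs : ∑ i, a i + ∑ i, b i = 2 * T := by
    rw [← hT, ← Finset.sum_add_distrib]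
    refine Finset.sum_congr rfl fun i _ => ?_
    rcases le_total (p i) (q i) with h | h
    · simp only [ha, hb, min_eq_left h]; rw [abs_of_nonpos (by linarith)]; ring
    · simp only [ha, hb, min_eq_right h]; rw [abs_of_nonneg (by linarith)]; ring
  have hdiff : ∑ i, a i - ∑ i, b i = 0 := by
    simp only [ha, hb, Finset.sum_sub_distrib, hp1, hq1]; ring
  have haT : ∑ i, a i = T := by linarith
  have hbT : ∑ i, b i = T := by linarith
  set w : n → n → ℝ := fun i j => (if i = j then min (p i) (q i) else 0) + a i * b j / T with hw
  have hw0 : ∀ i j, 0 ≤ w i j := by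
    intro i j
    refine add_nonneg ?_ (div_nonneg (mul_nonneg (ha0 i) (hb0 j)) hT0.le)
    split_ifs
    · exact le_min (hp i) (hq i)
    · exact le_rfl
  have hwrow : ∀ i, ∑ j, w i j = p i := by
    intro i
    simp only [hw, Finset.sum_add_distrib, ← Finset.sum_div, ← Finset.mul_sum, hbT,
      mul_div_cancel_right₀ _ hT0.ne']
    simp [ha]
  have hwcol : ∀ j, ∑ i, w i j = q j := by
    intro j
    simp only [hw, Finset.sum_add_distrib, ← Finset.sum_div, ← Finset.sum_mul, haT,
      mul_div_cancel_left₀ _ hT0.ne']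
    simp [hb]
  have hwdiag : ∑ j, w j j = 1 - T := by
    simp only [hw, if_true, hab, zero_div, add_zero]
    rw [← haT, ← hp1, ← Finset.sum_sub_distrib]
    exact Finset.sum_congr rfl fun i _ => by simp [ha]
  -- the total variation distance of distributions on one point is zero
  have hd : 2 ≤ Fintype.card n := by
    by_contra hcard
    have : Subsingleton n := Fintype.card_le_one_iff_subsingleton.mp (by omega)
    have hpq : ∀ i, p i = q i := fun i => by
      rw [← Finset.sum_eq_single_of_mem (f := p) i (Finset.mem_univ i)
        (fun j _ h => absurd (Subsingleton.elim j i) h), hp1, ← hq1]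
      exact Finset.sum_eq_single_of_mem (f := q) i (Finset.mem_univ i)
        (fun j _ h => absurd (Subsingleton.elim j i) h)
    have : (0 : ℝ) = 2 * T := by rw [← hT]; simp [hpq]
    linarith
  set D : ℝ := (Fintype.card n : ℝ) - 1 with hD
  have hDpos : 0 < D := by
    have : (2 : ℝ) ≤ Fintype.card n := by exact_mod_cast hd
    linarith
  set K : n → n → ℝ := fun i j => if i = j then 1 - T else T / D with hK
  have hKpos : ∀ i j, 0 < K i j := by
    intro i j
    simp only [hK]
    split_ifs
    · linarith
    · exact div_pos hT0 hDpos
  have hKcol : ∀ j, ∑ i, K i j = 1 := by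
    intro j
    have : ∀ i, K i j = T / D + if i = j then 1 - T - T / D else 0 := by
      intro i
      simp only [hK]
      split_ifs <;> ring
    simp only [this, Finset.sum_add_distrib, Finset.sum_ite_eq', Finset.mem_univ, if_true,
      Finset.sum_const, Finset.card_univ, nsmul_eq_mul]
    rw [show (Fintype.card n : ℝ) = D + 1 by rw [hD]; ring]
    field_simp
    ring
  have hstep1 : ∑ i, Real.negMulLog (p i) ≤ ∑ i, ∑ j, Real.negMulLog (w i j) := by
    refine Finset.sum_le_sum fun i _ => ?_
    have hle : ∀ j, w i j ≤ p i := fun j => by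
      rw [← hwrow i]
      exact Finset.single_le_sum (fun j _ => hw0 i j) (Finset.mem_univ j)
    have : Real.negMulLog (p i) = ∑ j, -(w i j * Real.log (p i)) := by
      rw [Finset.sum_neg_distrib, ← Finset.sum_mul, hwrow, Real.negMulLog]; ring
    rw [this]
    refine Finset.sum_le_sum fun j _ => ?_
    rcases (hw0 i j).eq_or_lt with h | h
    · simp [← h]
    · have := mul_le_mul_of_nonneg_left (Real.log_le_log h (hle j)) h.le
      rw [Real.negMulLog]
      linarith
  have hstep2 : ∑ i, ∑ j, Real.negMulLog (w i j) ≤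
      ∑ i, ∑ j, (-(w i j * Real.log (q j)) - w i j * Real.log (K i j)
        + (q j * K i j - w i j)) := by
    refine Finset.sum_le_sum fun i _ => Finset.sum_le_sum fun j _ => ?_
    have hwq : q j = 0 → w i j = 0 := fun h => by
      refine le_antisymm ?_ (hw0 i j)
      rw [← h, ← hwcol j]
      exact Finset.single_le_sum (f := fun i => w i j) (fun i _ => hw0 i j) (Finset.mem_univ i)
    refine (negMulLog_le_sub (hw0 i j) (mul_nonneg (hq j) (hKpos i j).le) fun h =>
      hwq ((mul_eq_zero.mp h).resolve_right (hKpos i j).ne')).trans (le_of_eq ?_)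
    by_cases h : q j = 0
    · rw [hwq h]; simp
    · rw [Real.log_mul h (hKpos i j).ne']; ring
  have hterm1 : ∑ i, ∑ j, w i j * Real.log (q j) = -∑ j, Real.negMulLog (q j) := by
    rw [Finset.sum_comm, ← Finset.sum_neg_distrib]
    refine Finset.sum_congr rfl fun j _ => ?_
    rw [← Finset.sum_mul, hwcol, Real.negMulLog]; ring
  have hterm2 : ∑ i, ∑ j, w i j * Real.log (K i j) =
      (1 - T) * Real.log (1 - T) + T * Real.log (T / D) := by
    have : ∀ i j, w i j * Real.log (K i j) = w i j * Real.log (T / D) +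
        if i = j then w j j * (Real.log (1 - T) - Real.log (T / D)) else 0 := by
      intro i j
      simp only [hK]
      split_ifs with h
      · rw [h]; ring
      · ring
    simp only [this, Finset.sum_add_distrib, Finset.sum_ite_eq, Finset.mem_univ, if_true,
      ← Finset.sum_mul, hwrow, hwdiag, hp1]
    ring
  have hterm3 : ∑ i, ∑ j, (q j * K i j - w i j) = 0 := by
    simp only [Finset.sum_sub_distrib, hwrow, hp1]
    rw [Finset.sum_comm]
    simp only [← Finset.mul_sum, hKcol, mul_one, hq1, sub_self]
  have hq_entropy : Real.qaryEntropy (Fintype.card n) T =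
      -((1 - T) * Real.log (1 - T) + T * Real.log (T / D)) := by
    rw [Real.qaryEntropy, Real.binEntropy, Real.log_div hT0.ne' hDpos.ne', Real.log_inv,
      Real.log_inv, hD]
    push_cast
    ring
  simp only [Finset.sum_add_distrib, Finset.sum_sub_distrib, Finset.sum_neg_distrib]
    at hstep2 hterm3
  rw [hq_entropy]
  linarith

/-- The classical Fannes–Audenaert inequality, for a bound `T` on the total variation distance. -/
theorem abs_sum_negMulLog_sub_le {p q : n → ℝ} (hp : ∀ i, 0 ≤ p i) (hq : ∀ i, 0 ≤ q i)
    (hp1 : ∑ i, p i = 1) (hq1 : ∑ i, q i = 1) {T : ℝ} (hT : ∑ i, |p i - q i| ≤ 2 * T)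
    (hT1 : T ≤ 1 / 2) :
    |∑ i, Real.negMulLog (p i) - ∑ i, Real.negMulLog (q i)| ≤
      Real.qaryEntropy (Fintype.card n) T := by
  obtain ⟨S, hS⟩ : ∃ S, ∑ i, |p i - q i| = 2 * S := ⟨(∑ i, |p i - q i|) / 2, by ring⟩
  have hS0 : 0 ≤ S := by
    have := Finset.sum_nonneg (s := Finset.univ) fun i _ => abs_nonneg (p i - q i)
    linarith
  rcases hS0.eq_or_lt with h0 | hpos
  · have hpq : ∀ i, p i = q i := fun i => by
      have h := (Finset.sum_eq_zero_iff_of_nonneg fun i _ => abs_nonneg (p i - q i)).mp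
        (hS.trans (by rw [← h0]; ring)) i (Finset.mem_univ i)
      exact sub_eq_zero.mp (abs_eq_zero.mp h)
    have : 0 ≤ Real.qaryEntropy (Fintype.card n) T :=
      Real.qaryEntropy_nonneg (by linarith) (by linarith)
    simpa [hpq] using this
  · have hne : Nonempty n := by
      by_contra h
      rw [not_nonempty_iff] at h
      simp at hp1
    refine le_trans ?_ (qaryEntropy_le_qaryEntropy Fintype.card_pos hpos.le (by linarith) hT1)
    refine abs_le.mpr ⟨?_, sum_negMulLog_sub_le hp hq hp1 hq1 hS hpos (by linarith)⟩
    have := sum_negMulLog_sub_le hq hp hq1 hp1 (T := S)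
      (by rw [← hS]; exact Finset.sum_congr rfl fun i _ => abs_sub_comm _ _) hpos (by linarith)
    linarith

theorem IsState.entropy_eq {ρ : Matrix n n ℂ} (hρ : IsState ρ) :
    entropy ρ = ∑ i, Real.negMulLog (hρ.1.isHermitian.eigenvalues i) := by
  rw [entropy, dif_pos hρ.1.isHermitian, ← Finset.sum_neg_distrib]
  exact Finset.sum_congr rfl fun i _ => by rw [Real.negMulLog]; ring

theorem IsState.sum_eigenvalues {ρ : Matrix n n ℂ} (hρ : IsState ρ) :
    ∑ i, hρ.1.isHermitian.eigenvalues i = 1 := by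
  rw [← trace_re_eq_sum_eigenvalues, hρ.2, Complex.one_re]

/-- The **Fannes–Audenaert inequality**. -/
theorem abs_entropy_sub_le {ρ σ : Matrix n n ℂ} (hρ : IsState ρ) (hσ : IsState σ) {c : ℝ}
    (h : HasTraceNormBound (ρ - σ) c) (hc : c ≤ 1) :
    |entropy ρ - entropy σ| ≤ Real.qaryEntropy (Fintype.card n) (c / 2) := by
  rw [hρ.entropy_eq, hσ.entropy_eq]
  refine abs_sum_negMulLog_sub_le hρ.1.eigenvalues_nonneg hσ.1.eigenvalues_nonneg
    hρ.sum_eigenvalues hσ.sum_eigenvalues ?_ (by linarith)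
  rw [mul_div_cancel₀ _ two_ne_zero]
  exact h.sum_abs_eigenvalues_sub_le hρ.1.isHermitian hσ.1.isHermitian

end EntropyContinuity

/-! ### Partial traces and local measurements -/

section LocalMeasurement

variable {A B : Type*} [Fintype A] [DecidableEq A] [Fintype B] [DecidableEq B]

set_option linter.unusedSectionVars false

/-- The block of a matrix on `A × B` with the given `B`-indices, a matrix on `A`. -/
def blockA (X : Matrix (A × B) (A × B) ℂ) (b b' : B) : Matrix A A ℂ :=
  X.submatrix (fun a => (a, b)) fun a => (a, b')

theorem blockA_kronecker_mul_mul (X : Matrix (A × B) (A × B) ℂ) (M N : Matrix A A ℂ) (b b' : B) :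
    blockA ((M ⊗ₖ (1 : Matrix B B ℂ)) * X * (N ⊗ₖ (1 : Matrix B B ℂ))) b b' =
      M * blockA X b b' * N := by
  ext a a'
  simp [blockA, Matrix.mul_apply, Matrix.one_apply, Fintype.sum_prod_type]

theorem reduceA_eq_sum_blockA (X : Matrix (A × B) (A × B) ℂ) :
    reduceA X = ∑ b, blockA X b b := by
  ext a a'
  simp [reduceA, blockA, Matrix.sum_apply]

theorem reduceB_eq_trace_blockA (X : Matrix (A × B) (A × B) ℂ) :
    reduceB X = Matrix.of fun b b' => (blockA X b b').trace :=
  rfl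

theorem reduceA_kronecker_mul_mul (X : Matrix (A × B) (A × B) ℂ) (M N : Matrix A A ℂ) :
    reduceA ((M ⊗ₖ (1 : Matrix B B ℂ)) * X * (N ⊗ₖ (1 : Matrix B B ℂ))) =
      M * reduceA X * N := by
  simp only [reduceA_eq_sum_blockA, blockA_kronecker_mul_mul, Finset.mul_sum, Finset.sum_mul]

theorem trace_reduceA (X : Matrix (A × B) (A × B) ℂ) : (reduceA X).trace = X.trace := by
  simp [reduceA, Matrix.trace, Fintype.sum_prod_type]

theorem reduceA_sub (X Y : Matrix (A × B) (A × B) ℂ) :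
    reduceA (X - Y) = reduceA X - reduceA Y := by
  ext a a'
  simp [reduceA]

theorem reduceA_sum {ι : Type*} (s : Finset ι) (X : ι → Matrix (A × B) (A × B) ℂ) :
    reduceA (∑ i ∈ s, X i) = ∑ i ∈ s, reduceA (X i) := by
  ext a a'
  simp only [reduceA, Matrix.of_apply, Matrix.sum_apply]
  exact Finset.sum_comm

theorem reduceB_sum {ι : Type*} (s : Finset ι) (X : ι → Matrix (A × B) (A × B) ℂ) :
    reduceB (∑ i ∈ s, X i) = ∑ i ∈ s, reduceB (X i) := by
  ext b b'
  simp only [reduceB, Matrix.of_apply, Matrix.sum_apply]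
  exact Finset.sum_comm

theorem posSemidef_reduceA {X : Matrix (A × B) (A × B) ℂ} (hX : X.PosSemidef) :
    (reduceA X).PosSemidef := by
  rw [reduceA_eq_sum_blockA]
  exact Matrix.posSemidef_sum _ fun b _ => hX.submatrix _

theorem HasTraceNormBound.reduceA {X : Matrix (A × B) (A × B) ℂ} {c : ℝ}
    (h : HasTraceNormBound X c) : HasTraceNormBound (reduceA X) c := by
  obtain ⟨P, N, hP, hN, rfl, hc⟩ := h
  refine ⟨_, _, posSemidef_reduceA hP, posSemidef_reduceA hN, reduceA_sub P N, ?_⟩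
  rwa [trace_reduceA, trace_reduceA]

theorem conjTranspose_kronecker_one (M : Matrix A A ℂ) :
    (M ⊗ₖ (1 : Matrix B B ℂ)).conjTranspose = M.conjTranspose ⊗ₖ (1 : Matrix B B ℂ) := by
  rw [Matrix.conjTranspose_kronecker, Matrix.conjTranspose_one]

theorem posSemidef_kronecker_mul_mul {X : Matrix (A × B) (A × B) ℂ} (hX : X.PosSemidef)
    {M : Matrix A A ℂ} (hM : M.IsHermitian) :
    ((M ⊗ₖ (1 : Matrix B B ℂ)) * X * (M ⊗ₖ (1 : Matrix B B ℂ))).PosSemidef := by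
  have h := hX.mul_mul_conjTranspose_same (M ⊗ₖ (1 : Matrix B B ℂ))
  rwa [conjTranspose_kronecker_one, hM.eq] at h

theorem trace_kronecker_mul_mul (X : Matrix (A × B) (A × B) ℂ) (M : Matrix A A ℂ) :
    ((M ⊗ₖ (1 : Matrix B B ℂ)) * X * (M ⊗ₖ (1 : Matrix B B ℂ))).trace =
      (M * M * reduceA X).trace := by
  rw [← trace_reduceA, reduceA_kronecker_mul_mul, Matrix.trace_mul_comm, mul_assoc]

theorem posSemidef_measureA (e : OrthonormalBasis A ℂ (EuclideanSpace ℂ A))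
    {X : Matrix (A × B) (A × B) ℂ} (hX : X.PosSemidef) : (measureA e X).PosSemidef :=
  Matrix.posSemidef_sum _ fun i _ => posSemidef_kronecker_mul_mul hX (conjTranspose_proj e i)

theorem trace_measureA (e : OrthonormalBasis A ℂ (EuclideanSpace ℂ A))
    (X : Matrix (A × B) (A × B) ℂ) : (measureA e X).trace = X.trace := by
  simp only [measureA, Matrix.trace_sum, trace_kronecker_mul_mul, proj_mul_proj, if_true]
  rw [← Matrix.trace_sum, ← Finset.sum_mul, sum_proj, one_mul, trace_reduceA]

theorem measureA_sub (e : OrthonormalBasis A ℂ (EuclideanSpace ℂ A))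
    (X Y : Matrix (A × B) (A × B) ℂ) : measureA e (X - Y) = measureA e X - measureA e Y := by
  simp only [measureA, mul_sub, sub_mul, Finset.sum_sub_distrib]

theorem IsState.measureA {ρ : Matrix (A × B) (A × B) ℂ} (hρ : IsState ρ)
    (e : OrthonormalBasis A ℂ (EuclideanSpace ℂ A)) : IsState (measureA e ρ) :=
  ⟨posSemidef_measureA e hρ.1, (trace_measureA e ρ).trans hρ.2⟩

theorem HasTraceNormBound.measureA {X : Matrix (A × B) (A × B) ℂ} {c : ℝ}
    (h : HasTraceNormBound X c) (e : OrthonormalBasis A ℂ (EuclideanSpace ℂ A)) :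
    HasTraceNormBound (measureA e X) c := by
  obtain ⟨P, N, hP, hN, rfl, hc⟩ := h
  refine ⟨_, _, posSemidef_measureA e hP, posSemidef_measureA e hN, measureA_sub e P N, ?_⟩
  rwa [trace_measureA, trace_measureA]

theorem reduceA_measureA {e : OrthonormalBasis A ℂ (EuclideanSpace ℂ A)}
    {X : Matrix (A × B) (A × B) ℂ} (he : e ∈ eigenbases (reduceA X)) :
    reduceA (measureA e X) = reduceA X := by
  obtain ⟨p, hp⟩ := he
  simp only [measureA, reduceA_sum, reduceA_kronecker_mul_mul]
  rw [hp]
  refine Finset.sum_congr rfl fun i _ => ?_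
  simp [Finset.mul_sum, proj_mul_proj]

theorem reduceB_measureA (e : OrthonormalBasis A ℂ (EuclideanSpace ℂ A))
    (X : Matrix (A × B) (A × B) ℂ) : reduceB (measureA e X) = reduceB X := by
  have hterm : ∀ i, reduceB ((proj e i ⊗ₖ (1 : Matrix B B ℂ)) * X *
      (proj e i ⊗ₖ (1 : Matrix B B ℂ))) =
      Matrix.of fun b b' => (proj e i * blockA X b b').trace := by
    intro i
    simp only [reduceB_eq_trace_blockA, blockA_kronecker_mul_mul]
    ext b b'
    simp only [Matrix.of_apply]
    rw [Matrix.trace_mul_comm, ← mul_assoc, proj_mul_proj, if_pos rfl]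
  ext b b'
  rw [measureA, reduceB_sum, Finset.sum_congr rfl fun i _ => hterm i]
  simp only [Matrix.sum_apply, Matrix.of_apply]
  rw [← Matrix.trace_sum, ← Finset.sum_mul, sum_proj, one_mul, reduceB_eq_trace_blockA,
    Matrix.of_apply]

/-- A measurement in an eigenbasis of the marginal disturbs neither marginal, so that it changes
the mutual information only through the global entropy. -/
theorem mutualInformation_measureA {e : OrthonormalBasis A ℂ (EuclideanSpace ℂ A)}
    {X : Matrix (A × B) (A × B) ℂ} (he : e ∈ eigenbases (reduceA X)) :
    mutualInformation (measureA e X) =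
      entropy (reduceA X) + entropy (reduceB X) - entropy (measureA e X) := by
  rw [mutualInformation, reduceA_measureA he, reduceB_measureA]

theorem eigenbases_nonempty {M : Matrix A A ℂ} (hM : M.IsHermitian) : (eigenbases M).Nonempty :=
  ⟨hM.eigenvectorBasis, hM.eigenvalues, eq_sum_eigenvalues_smul_proj hM⟩

end LocalMeasurement

/-! ### Perturbation of eigenbases -/

section EigenbasisPerturbation

variable {n : Type*} [Fintype n] [DecidableEq n]

theorem sum_sum_overlap_eq_one (e e' : OrthonormalBasis n ℂ (EuclideanSpace ℂ n)) (j : n) :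
    ∑ i, (proj e j * proj e' i).trace.re = 1 := by
  simp only [Matrix.trace_mul_comm (proj e j)]
  rw [sum_trace_proj_mul, trace_proj, Complex.one_re]

/-- The squared Frobenius distance of two Hermitian matrices is the sum of the squared distances
of their eigenvalues, weighted by the overlaps of the eigenprojections. -/
theorem trace_sub_sq_eq_sum_overlap (e e' : OrthonormalBasis n ℂ (EuclideanSpace ℂ n))
    {p p' : n → ℝ} {M M' : Matrix n n ℂ} (hM : M = ∑ i, (p i : ℂ) • proj e i)
    (hM' : M' = ∑ i, (p' i : ℂ) • proj e' i) :
    ((M' - M) * (M' - M)).trace.re =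
      ∑ j, ∑ i, (p j - p' i) ^ 2 * (proj e j * proj e' i).trace.re := by
  have h1 : (M * M).trace.re = ∑ j, ∑ i, p j * p j * (proj e j * proj e' i).trace.re := by
    rw [hM, sum_smul_proj_mul, trace_sum_smul_proj]
    simp only [← Finset.mul_sum, sum_sum_overlap_eq_one, mul_one]
  have h2 : (M' * M').trace.re = ∑ j, ∑ i, p' i * p' i * (proj e j * proj e' i).trace.re := by
    rw [hM', sum_smul_proj_mul, trace_sum_smul_proj, Finset.sum_comm]
    refine Finset.sum_congr rfl fun i _ => ?_
    rw [← Finset.mul_sum, sum_trace_proj_mul, trace_proj, Complex.one_re, mul_one]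
  have h3 : (M * M').trace.re = ∑ j, ∑ i, p j * p' i * (proj e j * proj e' i).trace.re := by
    rw [hM, hM', Finset.sum_mul, Matrix.trace_sum, Complex.re_sum]
    refine Finset.sum_congr rfl fun j _ => ?_
    rw [Finset.mul_sum, Matrix.trace_sum, Complex.re_sum]
    refine Finset.sum_congr rfl fun i _ => ?_
    simp [Matrix.trace_smul, mul_assoc, mul_left_comm]
  simp only [sub_mul, mul_sub, Matrix.trace_sub, Complex.sub_re, Matrix.trace_mul_comm M' M]
  rw [h1, h2, h3]
  simp only [← Finset.sum_sub_distrib]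
  refine Finset.sum_congr rfl fun j _ => Finset.sum_congr rfl fun i _ => ?_
  ring

/-- If a doubly stochastic matrix `c` concentrates on pairs with close labels, in the mean square
sense, and the labels `p` are separated, then `c` is close to a permutation matrix. -/
theorem exists_perm_sum_one_sub_le {p p' : n → ℝ} {c : n → n → ℝ} (hc : ∀ j i, 0 ≤ c j i)
    (hrow : ∀ j, ∑ i, c j i = 1) (hcol : ∀ i, ∑ j, c j i = 1) {Δ ε : ℝ} (hε : 0 < ε)
    (hεΔ : 4 * ε ≤ Δ) (hgap : ∀ i j, i ≠ j → Δ ≤ |p i - p j|)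
    (hsum : ∑ j, ∑ i, (p j - p' i) ^ 2 * c j i ≤ ε ^ 2) :
    ∃ σ : Equiv.Perm n, ∑ i, (1 - c (σ i) i) ≤ 4 * ε ^ 2 / Δ ^ 2 := by
  have hΔ : 0 < Δ := by linarith
  rw [Finset.sum_comm] at hsum
  have hnn : ∀ i, 0 ≤ ∑ j, (p j - p' i) ^ 2 * c j i := fun i =>
    Finset.sum_nonneg fun j _ => mul_nonneg (sq_nonneg _) (hc j i)
  have hcoli : ∀ i, ∑ j, (p j - p' i) ^ 2 * c j i ≤ ε ^ 2 := fun i =>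
    (Finset.single_le_sum (f := fun i => ∑ j, (p j - p' i) ^ 2 * c j i) (fun i _ => hnn i)
      (Finset.mem_univ i)).trans hsum
  have hex : ∀ i, ∃ j, |p j - p' i| ≤ ε := by
    intro i
    by_contra! hfar
    have hlt : ∀ j, ε ^ 2 < (p j - p' i) ^ 2 := fun j => by
      rw [← sq_abs (p j - p' i)]
      exact pow_lt_pow_left₀ (hfar j) hε.le two_ne_zero
    have hpos : ∃ j, 0 < c j i := by
      by_contra! h
      have := Finset.sum_nonpos (s := Finset.univ) fun j _ => h j
      rw [hcol i] at this
      linarith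
    obtain ⟨j, hj⟩ := hpos
    have : ∑ j, ε ^ 2 * c j i < ∑ j, (p j - p' i) ^ 2 * c j i :=
      Finset.sum_lt_sum (fun j _ => mul_le_mul_of_nonneg_right (hlt j).le (hc j i))
        ⟨j, Finset.mem_univ j, mul_lt_mul_of_pos_right (hlt j) hj⟩
    rw [← Finset.mul_sum, hcol, mul_one] at this
    exact absurd (hcoli i) (not_le.mpr this)
  choose f hf using hex
  -- every label other than that of `f i` is at distance at least `Δ - ε ≥ Δ / 2` from `p' i`
  have hbound : ∀ i, Δ ^ 2 / 4 * (1 - c (f i) i) ≤ ∑ j, (p j - p' i) ^ 2 * c j i := by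
    intro i
    rw [← hcol i, ← Finset.add_sum_erase _ _ (Finset.mem_univ (f i)), add_sub_cancel_left,
      Finset.mul_sum, ← Finset.add_sum_erase (a := f i) _ (fun j => (p j - p' i) ^ 2 * c j i)
        (Finset.mem_univ (f i))]
    refine le_add_of_nonneg_of_le (mul_nonneg (sq_nonneg _) (hc _ _))
      (Finset.sum_le_sum fun j hj => mul_le_mul_of_nonneg_right ?_ (hc j i))
    have h1 := hgap j (f i) (Finset.ne_of_mem_erase hj)
    have h2 := abs_sub_le (p j) (p' i) (p (f i))
    rw [abs_sub_comm (p' i)] at h2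
    have h3 : Δ / 2 ≤ |p j - p' i| := by linarith [hf i]
    rw [← sq_abs (p j - p' i)]
    calc Δ ^ 2 / 4 = (Δ / 2) ^ 2 := by ring
      _ ≤ _ := pow_le_pow_left₀ (by linarith) h3 2
  -- a row of sum one cannot hold two entries that are both at least `3 / 4`
  have hinj : Function.Injective f := by
    intro i k hik
    by_contra hne
    have hpair : c (f i) i + c (f i) k ≤ 1 := by
      rw [← hrow (f i), ← Finset.sum_pair hne]
      exact Finset.sum_le_sum_of_subset_of_nonneg (Finset.subset_univ _)
        fun j _ _ => hc (f i) j
    have h1 := (hbound i).trans (hcoli i)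
    have h2 := (hbound k).trans (hcoli k)
    rw [← hik] at h2
    have h4 : Δ ^ 2 / 4 ≤ 2 * ε ^ 2 := by nlinarith [sq_nonneg Δ]
    nlinarith
  refine ⟨Equiv.ofBijective f (Finite.injective_iff_bijective.mp hinj), ?_⟩
  rw [le_div_iff₀ (by positivity)]
  have : ∑ i, Δ ^ 2 / 4 * (1 - c (f i) i) ≤ ε ^ 2 :=
    (Finset.sum_le_sum fun i _ => hbound i).trans hsum
  rw [← Finset.mul_sum] at this
  simp only [Equiv.ofBijective_apply]
  linarith

/-- Two Hermitian matrices at distance small against the spectral gap of the first have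
eigenbases which agree up to order, phases and a small error. This is an averaged form of the
Davis–Kahan theorem. -/
theorem exists_perm_sum_one_sub_overlap_le
    {e e' : OrthonormalBasis n ℂ (EuclideanSpace ℂ n)} {p : n → ℝ} {M M' : Matrix n n ℂ}
    (hM : M = ∑ i, (p i : ℂ) • proj e i) (hM' : e' ∈ eigenbases M') {Δ ε : ℝ} (hε : 0 < ε)
    (hεΔ : 4 * ε ≤ Δ) (hgap : ∀ i j, i ≠ j → Δ ≤ |p i - p j|)
    (hdist : HasTraceNormBound (M' - M) ε) :
    ∃ σ : Equiv.Perm n, ∑ i, (1 - (proj e (σ i) * proj e' i).trace.re) ≤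
      4 * ε ^ 2 / Δ ^ 2 := by
  obtain ⟨p', hp'⟩ := hM'
  refine exists_perm_sum_one_sub_le (p := p) (p' := p')
    (c := fun j i => (proj e j * proj e' i).trace.re)
    (fun j i => trace_proj_mul_re_nonneg e j (proj_posSemidef e' i))
    (sum_sum_overlap_eq_one e e')
    (fun i => by rw [sum_trace_proj_mul, trace_proj, Complex.one_re]) hε hεΔ hgap ?_
  rw [← trace_sub_sq_eq_sum_overlap e e' hM hp']
  exact hdist.trace_sq_le

theorem HasTraceNormBound.sum {ι : Type*} (s : Finset ι) {X : ι → Matrix n n ℂ} {c : ι → ℝ}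
    (h : ∀ i ∈ s, HasTraceNormBound (X i) (c i)) :
    HasTraceNormBound (∑ i ∈ s, X i) (∑ i ∈ s, c i) := by
  classical
  induction s using Finset.induction_on with
  | empty => exact ⟨0, 0, .zero, .zero, by simp, by simp⟩
  | insert i s hi ih =>
    rw [Finset.sum_insert hi, Finset.sum_insert hi]
    exact (h i (Finset.mem_insert_self i s)).add
      (ih fun j hj => h j (Finset.mem_insert_of_mem hj))

/-- A trace norm estimate of the Cauchy–Schwarz type, with the weight `t` of the
arithmetic–geometric mean inequality left free: for `D = G - H` and `S = G + H`,
`GXG - HXH = (DXS + SXD) / 2` lies between `∓ (t DXD + t⁻¹ SXS) / 2`. -/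
theorem hasTraceNormBound_conj_sub_conj {X G H : Matrix n n ℂ} (hX : X.PosSemidef)
    (hG : G.IsHermitian) (hH : H.IsHermitian) {t : ℝ} (ht : 0 < t) :
    HasTraceNormBound (G * X * G - H * X * H)
      (t / 2 * ((G - H) * X * (G - H)).trace.re +
        (2 * t)⁻¹ * ((G + H) * X * (G + H)).trace.re) := by
  have htC : (t : ℂ) ≠ 0 := by exact_mod_cast ht.ne'
  have hpos : (0 : ℂ) ≤ (((2 * t)⁻¹ : ℝ) : ℂ) := Complex.zero_le_real.mpr (by positivity)
  have hsq : ∀ {K : Matrix n n ℂ}, K.IsHermitian → (K * X * K).PosSemidef := fun {K} hK => by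
    have h := hX.mul_mul_conjTranspose_same K
    rwa [hK.eq] at h
  have htD : ((t : ℂ) • (G - H)).IsHermitian := by
    rw [Matrix.IsHermitian, Matrix.conjTranspose_smul, (hG.sub hH).eq]
    simp
  have h₁ := (hsq (htD.add (hG.add hH))).smul hpos
  have h₂ := (hsq (htD.sub (hG.add hH))).smul hpos
  have hbound := hasTraceNormBound_of_le (M := G * X * G - H * X * H)
    (Q := ((t / 2 : ℝ) : ℂ) • ((G - H) * X * (G - H)) +
      (((2 * t)⁻¹ : ℝ) : ℂ) • ((G + H) * X * (G + H))) ?_ ?_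
  · refine hbound.mono (le_of_eq ?_)
    rw [Matrix.trace_add, Matrix.trace_smul, Matrix.trace_smul, Complex.add_re, smul_eq_mul,
      smul_eq_mul, Complex.re_ofReal_mul, Complex.re_ofReal_mul]
  · convert h₁ using 1
    simp only [mul_add, add_mul, mul_sub, sub_mul, Matrix.smul_mul, Matrix.mul_smul]
    push_cast
    match_scalars <;> field_simp <;> ring
  · convert h₂ using 1
    simp only [mul_add, add_mul, mul_sub, sub_mul, Matrix.smul_mul, Matrix.mul_smul]
    push_cast
    match_scalars <;> field_simp <;> ring

end EigenbasisPerturbation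

/-! ### Perturbation of the local measurement -/

section MeasurementPerturbation

variable {A B : Type*} [Fintype A] [DecidableEq A] [Fintype B] [DecidableEq B]

/-- Measurements in eigenbases of nearby marginals have nearby effects, if the first marginal has
spectral gap `Δ`. The weight `t = Δ / ε` balances the two terms of
`hasTraceNormBound_conj_sub_conj`, of orders `t (ε / Δ) ^ 2` and `t⁻¹`. -/
theorem hasTraceNormBound_measureA_sub_measureA {ρ : Matrix (A × B) (A × B) ℂ} (hρ : IsState ρ)
    {e e' : OrthonormalBasis A ℂ (EuclideanSpace ℂ A)} {p : A → ℝ} {M' : Matrix A A ℂ}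
    (he : reduceA ρ = ∑ i, (p i : ℂ) • proj e i) (he' : e' ∈ eigenbases M') {Δ ε : ℝ}
    (hε : 0 < ε) (hεΔ : 4 * ε ≤ Δ) (hgap : ∀ i j, i ≠ j → Δ ≤ |p i - p j|)
    (hdist : HasTraceNormBound (M' - reduceA ρ) ε) :
    HasTraceNormBound (measureA e' ρ - measureA e ρ) (6 * ε / Δ) := by
  have hΔ : 0 < Δ := by linarith
  obtain ⟨σ, hσ⟩ := exists_perm_sum_one_sub_overlap_le he he' hε hεΔ hgap hdist
  have ht : 0 < Δ / ε := div_pos hΔ hε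
  have hR := posSemidef_reduceA hρ.1
  have hR1 : (reduceA ρ).trace.re = 1 := by rw [trace_reduceA, hρ.2, Complex.one_re]
  have hsub : measureA e' ρ - measureA e ρ = ∑ i,
      ((proj e' i ⊗ₖ (1 : Matrix B B ℂ)) * ρ * (proj e' i ⊗ₖ (1 : Matrix B B ℂ)) -
        (proj e (σ i) ⊗ₖ (1 : Matrix B B ℂ)) * ρ * (proj e (σ i) ⊗ₖ (1 : Matrix B B ℂ))) := by
    rw [Finset.sum_sub_distrib, Equiv.sum_comp σ fun j =>
      (proj e j ⊗ₖ (1 : Matrix B B ℂ)) * ρ * (proj e j ⊗ₖ (1 : Matrix B B ℂ))]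
    rfl
  have hherm : ∀ (b : OrthonormalBasis A ℂ (EuclideanSpace ℂ A)) (i : A),
      (proj b i ⊗ₖ (1 : Matrix B B ℂ)).IsHermitian := fun b i => by
    rw [Matrix.IsHermitian, conjTranspose_kronecker_one, conjTranspose_proj]
  rw [hsub]
  refine (HasTraceNormBound.sum Finset.univ fun i _ => hasTraceNormBound_conj_sub_conj hρ.1
    (hherm e' i) (hherm e (σ i)) ht).mono ?_
  have hterm : ∀ i, Δ / ε / 2 * (((proj e' i ⊗ₖ (1 : Matrix B B ℂ)) -
        (proj e (σ i) ⊗ₖ (1 : Matrix B B ℂ))) * ρ * ((proj e' i ⊗ₖ (1 : Matrix B B ℂ)) -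
        (proj e (σ i) ⊗ₖ (1 : Matrix B B ℂ)))).trace.re +
      (2 * (Δ / ε))⁻¹ * (((proj e' i ⊗ₖ (1 : Matrix B B ℂ)) +
        (proj e (σ i) ⊗ₖ (1 : Matrix B B ℂ))) * ρ * ((proj e' i ⊗ₖ (1 : Matrix B B ℂ)) +
        (proj e (σ i) ⊗ₖ (1 : Matrix B B ℂ)))).trace.re ≤
      Δ / ε / 2 * (2 * (1 - (proj e (σ i) * proj e' i).trace.re)) + (2 * (Δ / ε))⁻¹ *
        (2 * (proj e' i * reduceA ρ).trace.re + 2 * (proj e (σ i) * reduceA ρ).trace.re) := by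
    intro i
    set G := proj e' i
    set H := proj e (σ i)
    have hGG : G * G = G := by rw [proj_mul_proj, if_pos rfl]
    have hHH : H * H = H := by rw [proj_mul_proj, if_pos rfl]
    have hD : ((G - H) * (G - H)).PosSemidef := by
      have h := Matrix.posSemidef_self_mul_conjTranspose (G - H)
      rwa [Matrix.conjTranspose_sub, conjTranspose_proj, conjTranspose_proj] at h
    have hDtr : ((G - H) * (G - H)).trace.re = 2 * (1 - (H * G).trace.re) := by
      simp only [sub_mul, mul_sub, hGG, hHH, Matrix.trace_sub, Complex.sub_re,
        Matrix.trace_mul_comm G H]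
      rw [trace_proj, trace_proj, Complex.one_re]
      ring
    -- the parallelogram law bounds the square of the sum of the projections
    have hS : (G + H) * (G + H) = (2 : ℂ) • G + (2 : ℂ) • H - (G - H) * (G - H) := by
      simp only [sub_mul, mul_sub, add_mul, mul_add, hGG, hHH, two_smul]
      abel
    have hkron : G ⊗ₖ (1 : Matrix B B ℂ) - H ⊗ₖ (1 : Matrix B B ℂ) =
        (G - H) ⊗ₖ (1 : Matrix B B ℂ) := by
      ext x y
      simp [sub_mul]
    rw [hkron, ← Matrix.add_kronecker, trace_kronecker_mul_mul,
      trace_kronecker_mul_mul]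
    refine add_le_add (mul_le_mul_of_nonneg_left ?_ (by positivity))
      (mul_le_mul_of_nonneg_left ?_ (by positivity))
    · have := trace_mul_re_le hD hR
      rwa [hR1, mul_one, hDtr] at this
    · have := trace_mul_re_nonneg hD hR
      rw [hS, sub_mul, add_mul, Matrix.smul_mul, Matrix.smul_mul, Matrix.trace_sub,
        Matrix.trace_add, Matrix.trace_smul, Matrix.trace_smul]
      simp only [Complex.sub_re, Complex.add_re, smul_eq_mul, Complex.mul_re, Complex.re_ofNat,
        Complex.im_ofNat, zero_mul, sub_zero]
      linarith
  refine (Finset.sum_le_sum fun i _ => hterm i).trans ?_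
  rw [Finset.sum_add_distrib, ← Finset.mul_sum, ← Finset.mul_sum, ← Finset.mul_sum,
    Finset.sum_add_distrib, ← Finset.mul_sum, ← Finset.mul_sum, sum_trace_proj_mul,
    Equiv.sum_comp σ fun j => (proj e j * reduceA ρ).trace.re, sum_trace_proj_mul, hR1]
  have h1 := mul_le_mul_of_nonneg_left (mul_le_mul_of_nonneg_left hσ (zero_le_two (α := ℝ)))
    (by positivity : 0 ≤ Δ / ε / 2)
  refine (add_le_add_left h1 _).trans (le_of_eq ?_)
  field_simp
  ring

end MeasurementPerturbation

/-! ### Continuity of the diagonal discord -/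

section DiscordContinuity

variable {A B : Type*} [Fintype A] [DecidableEq A] [Fintype B] [DecidableEq B]

/-- If all differences `x - y` are within `η` of `k`, so is the difference of the suprema. Both sets
are then bounded, so no suprema of unbounded sets enter. -/
theorem abs_sSup_sub_sSup_sub_le {S S' : Set ℝ} (hS : S.Nonempty) (hS' : S'.Nonempty) {k η : ℝ}
    (h : ∀ x ∈ S, ∀ y ∈ S', |x - y - k| ≤ η) : |sSup S - sSup S' - k| ≤ η := by
  obtain ⟨x₀, hx₀⟩ := hS
  obtain ⟨y₀, hy₀⟩ := hS'
  have hle : ∀ x ∈ S, ∀ y ∈ S', x ≤ y + k + η := fun x hx y hy => by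
    linarith [(abs_le.mp (h x hx y hy)).2]
  have hge : ∀ x ∈ S, ∀ y ∈ S', y ≤ x - k + η := fun x hx y hy => by
    linarith [(abs_le.mp (h x hx y hy)).1]
  have hb : BddAbove S := ⟨y₀ + k + η, fun x hx => hle x hx y₀ hy₀⟩
  have hb' : BddAbove S' := ⟨x₀ - k + η, fun y hy => hge x₀ hx₀ y hy⟩
  refine abs_le.mpr ⟨?_, ?_⟩
  · have : sSup S' ≤ sSup S - k + η := csSup_le ⟨y₀, hy₀⟩ fun y hy => by
      linarith [hge x₀ hx₀ y hy, le_csSup hb hx₀]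
    linarith
  · have : sSup S ≤ sSup S' + k + η := csSup_le ⟨x₀, hx₀⟩ fun x hx => by
      linarith [hle x hx y₀ hy₀, le_csSup hb' hy₀]
    linarith

/-- A gap between the eigenvalues of a Hermitian matrix is one between the coefficients of any of
its spectral decompositions. -/
theorem gap_of_gap_eigenvalues {M : Matrix A A ℂ} (hM : M.IsHermitian) {Δ : ℝ} (hΔ : 0 < Δ)
    (hgap : ∀ i j, i ≠ j → Δ ≤ |hM.eigenvalues i - hM.eigenvalues j|)
    {e : OrthonormalBasis A ℂ (EuclideanSpace ℂ A)} {p : A → ℝ}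
    (hp : M = ∑ i, (p i : ℂ) • proj e i) {i j : A} (hij : i ≠ j) : Δ ≤ |p i - p j| := by
  have hmap := map_eq_map_eigenvalues hM e p hp
  have hinj : Function.Injective hM.eigenvalues := fun k l hkl => by
    by_contra hne
    have := hgap k l hne
    rw [hkl, sub_self, abs_zero] at this
    linarith
  have hpinj : Function.Injective p := by
    rw [← Fintype.nodup_map_univ_iff_injective, hmap]
    exact Fintype.nodup_map_univ_iff_injective.mpr hinj
  have hmem : ∀ i, ∃ k, hM.eigenvalues k = p i := fun i => by
    have : p i ∈ Finset.univ.val.map p := Multiset.mem_map_of_mem p (Finset.mem_univ i)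
    rw [hmap] at this
    obtain ⟨k, -, hk⟩ := Multiset.mem_map.mp this
    exact ⟨k, hk⟩
  obtain ⟨k, hk⟩ := hmem i
  obtain ⟨l, hl⟩ := hmem j
  rw [← hk, ← hl]
  refine hgap k l fun hkl => hij (hpinj ?_)
  rw [← hk, ← hl, hkl]

/-- The diagonal discord near a state whose marginal has spectral gap `Δ`. The discord is the
smallest increase of the global entropy under the measurement, and both the entropy of the state
and that of the measured state obey the Fannes–Audenaert inequality. -/
theorem abs_diagonalDiscord_sub_le {ρ ρ' : Matrix (A × B) (A × B) ℂ} (hρ : IsState ρ)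
    (hρ' : IsState ρ') {Δ ε : ℝ} (hΔ : 0 < Δ)
    (hgap : ∀ i j, i ≠ j → Δ ≤ |localSpectrum hρ i - localSpectrum hρ j|) (hε : 0 < ε)
    (hεΔ : 6 * ε / Δ + ε ≤ 1) (hdist : HasTraceNormBound (ρ' - ρ) ε) :
    |diagonalDiscord ρ' - diagonalDiscord ρ| ≤
      Real.qaryEntropy (Fintype.card (A × B)) (ε / 2) +
        Real.qaryEntropy (Fintype.card (A × B)) ((6 * ε / Δ + ε) / 2) := by
  have h6 : 0 < 6 * ε / Δ := by positivity
  have hε4 : 4 * ε ≤ Δ := by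
    have : 6 * ε / Δ ≤ 1 := by linarith
    rw [div_le_one hΔ] at this
    linarith
  have hmeas : ∀ e' ∈ eigenbases (reduceA ρ'), ∀ e ∈ eigenbases (reduceA ρ),
      |entropy (measureA e' ρ') - entropy (measureA e ρ)| ≤
        Real.qaryEntropy (Fintype.card (A × B)) ((6 * ε / Δ + ε) / 2) := by
    rintro e' he' e ⟨p, hp⟩
    have hredA : HasTraceNormBound (reduceA ρ' - reduceA ρ) ε := by
      rw [← reduceA_sub]
      exact hdist.reduceA
    have h := (hdist.measureA e').add (hasTraceNormBound_measureA_sub_measureA hρ hp he' hε hε4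
      (fun i j hij => gap_of_gap_eigenvalues hρ.isHermitian_reduceA hΔ hgap hp hij) hredA)
    rw [measureA_sub, sub_add_sub_cancel, add_comm] at h
    exact abs_entropy_sub_le (hρ'.measureA e') (hρ.measureA e) h hεΔ
  have hS := abs_entropy_sub_le hρ' hρ hdist (by linarith)
  have hsup := abs_sSup_sub_sSup_sub_le
    (S := (fun e => mutualInformation (measureA e ρ')) '' eigenbases (reduceA ρ'))
    (S' := (fun e => mutualInformation (measureA e ρ)) '' eigenbases (reduceA ρ))
    ((eigenbases_nonempty hρ'.isHermitian_reduceA).image _)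
    ((eigenbases_nonempty hρ.isHermitian_reduceA).image _)
    (k := entropy (reduceA ρ') + entropy (reduceB ρ') - (entropy (reduceA ρ) +
      entropy (reduceB ρ)))
    (η := Real.qaryEntropy (Fintype.card (A × B)) ((6 * ε / Δ + ε) / 2)) (by
      rintro _ ⟨e', he', rfl⟩ _ ⟨e, he, rfl⟩
      have h := hmeas e' he' e he
      simp only [mutualInformation_measureA he', mutualInformation_measureA he]
      rw [abs_sub_comm] at h
      convert h using 2
      ring)
  simp only [diagonalDiscord, mutualInformation] at hsup ⊢
  rw [abs_le] at hS hsup ⊢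
  constructor <;> linarith [hS.1, hS.2, hsup.1, hsup.2]

theorem exists_gap {ι : Type*} [Finite ι] {p : ι → ℝ} (hp : Function.Injective p) :
    ∃ Δ : ℝ, 0 < Δ ∧ ∀ i j, i ≠ j → Δ ≤ |p i - p j| := by
  rcases isEmpty_or_nonempty {x : ι × ι // x.1 ≠ x.2} with h | h
  · exact ⟨1, one_pos, fun i j hij => (h.false ⟨(i, j), hij⟩).elim⟩
  · obtain ⟨x, hx⟩ := Finite.exists_min fun x : {x : ι × ι // x.1 ≠ x.2} => |p x.1.1 - p x.1.2|
    exact ⟨_, abs_pos.mpr (sub_ne_zero.mpr fun h => x.2 (hp h)), fun i j hij => hx ⟨(i, j), hij⟩⟩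

theorem eventually_traceNorm_sub_le {n : Type*} [Fintype n] [DecidableEq n] (ρ : Matrix n n ℂ)
    {ε : ℝ} (hε : 0 < ε) : ∀ᶠ σ in nhds ρ, traceNorm (σ - ρ) ≤ ε := by
  have hcont : Continuous fun σ : Matrix n n ℂ =>
      (Fintype.card n : ℝ) * ((σ - ρ).conjTranspose * (σ - ρ)).trace.re := by
    fun_prop
  have h := hcont.tendsto ρ
  simp only [sub_self, mul_zero, Matrix.trace_zero, Complex.zero_re] at h
  filter_upwards [h.eventually (gt_mem_nhds (show (0 : ℝ) < ε ^ 2 by positivity))] with σ hσ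
  exact le_of_sq_le_sq ((traceNorm_sq_le _).trans hσ.le) hε.le

theorem continuousWithinAt_diagonalDiscord {ρ : Matrix (A × B) (A × B) ℂ} (hρ : IsState ρ)
    (hdistinct : Function.Injective (localSpectrum hρ)) :
    ContinuousWithinAt diagonalDiscord {σ : Matrix (A × B) (A × B) ℂ | IsState σ} ρ := by
  obtain ⟨Δ, hΔ, hgap⟩ := exists_gap hdistinct
  refine Metric.tendsto_nhds.mpr fun η hη => ?_
  have hF : Continuous fun ε : ℝ => Real.qaryEntropy (Fintype.card (A × B)) (ε / 2) +
      Real.qaryEntropy (Fintype.card (A × B)) ((6 * ε / Δ + ε) / 2) := by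
    fun_prop
  have hF0 := hF.tendsto 0
  simp only [zero_div, mul_zero, add_zero, Real.qaryEntropy_zero] at hF0
  have hG : Continuous fun ε : ℝ => 6 * ε / Δ + ε := by fun_prop
  have hG0 := hG.tendsto 0
  simp only [zero_div, mul_zero, add_zero] at hG0
  have hev : ∀ᶠ ε in nhdsWithin (0 : ℝ) (Set.Ioi 0), (0 < ε ∧ 6 * ε / Δ + ε < 1) ∧
      Real.qaryEntropy (Fintype.card (A × B)) (ε / 2) +
      Real.qaryEntropy (Fintype.card (A × B)) ((6 * ε / Δ + ε) / 2) < η :=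
    (eventually_mem_nhdsWithin.and ((hG0.eventually (gt_mem_nhds one_pos)).filter_mono
      nhdsWithin_le_nhds)).and ((hF0.eventually (gt_mem_nhds hη)).filter_mono nhdsWithin_le_nhds)
  obtain ⟨ε, ⟨hε, hε1⟩, hFε⟩ := hev.exists
  filter_upwards [(eventually_traceNorm_sub_le ρ hε).filter_mono nhdsWithin_le_nhds,
    self_mem_nhdsWithin] with σ hσ hstate
  have hdist : HasTraceNormBound (σ - ρ) ε :=
    (hasTraceNormBound_traceNorm (hstate.1.isHermitian.sub hρ.1.isHermitian)).mono hσ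
  rw [Real.dist_eq]
  exact (abs_diagonalDiscord_sub_le hρ hstate hΔ hgap hε hε1.le hdist).trans_lt hFε

end DiscordContinuity

end DiagonalDiscord

theorem mainTheorem3 {A B : Type*} [Fintype A] [DecidableEq A] [Fintype B] [DecidableEq B]
    (ρ : Matrix (A × B) (A × B) ℂ) (hρ : DiagonalDiscord.IsState ρ)
    (hdistinct : Function.Injective (DiagonalDiscord.localSpectrum hρ)) :
    ContinuousWithinAt DiagonalDiscord.diagonalDiscord
        {σ : Matrix (A × B) (A × B) ℂ | DiagonalDiscord.IsState σ} ρ ∧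
    ∀ Δ : ℝ,
      IsLeast {δ : ℝ | ∃ i j : A, i ≠ j ∧
        δ = |DiagonalDiscord.localSpectrum hρ i - DiagonalDiscord.localSpectrum hρ j|} Δ →
      ∃ ε₀ : ℝ, 0 < ε₀ ∧ ∀ ε : ℝ, 0 < ε → ε ≤ ε₀ →
        ∀ ρ' : Matrix (A × B) (A × B) ℂ, DiagonalDiscord.IsState ρ' →
          DiagonalDiscord.traceNorm (ρ' - ρ) ≤ ε →
          |DiagonalDiscord.diagonalDiscord ρ' - DiagonalDiscord.diagonalDiscord ρ| ≤
            (√(2 * (Fintype.card A : ℝ) ^ 3 * (Fintype.card B : ℝ) ^ 3) / Δ + 1) * ε *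
                Real.log ((Fintype.card A : ℝ) * (Fintype.card B : ℝ) - 1) +
              Real.binEntropy
                (1 / 2 * (2 * √(2 * (Fintype.card A : ℝ) ^ 3 * (Fintype.card B : ℝ) ^ 3) / Δ + 1)
                  * ε) +
              Real.binEntropy (ε / 2) := by
  refine ⟨DiagonalDiscord.continuousWithinAt_diagonalDiscord hρ hdistinct, fun Δ hleast => ?_⟩
  obtain ⟨⟨i, j, hij, hΔij⟩, hmin⟩ := hleast
  have hΔ : 0 < Δ := by
    rw [hΔij]
    exact abs_pos.mpr (sub_ne_zero.mpr (hdistinct.ne hij))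
  have hA : 2 ≤ Fintype.card A := Fintype.one_lt_card_iff.mpr ⟨i, j, hij⟩
  have hne : Nonempty (A × B) := by
    by_contra h
    rw [not_nonempty_iff] at h
    have := hρ.2
    simp [Matrix.trace] at this
  have hB : 1 ≤ Fintype.card B := Fintype.card_pos_iff.mpr ⟨(Classical.arbitrary (A × B)).2⟩
  set K : ℝ := √(2 * (Fintype.card A : ℝ) ^ 3 * (Fintype.card B : ℝ) ^ 3) with hK
  -- `3` is what turns `6 ε / Δ` into a bound by `2 K ε / Δ`
  have hK3 : 3 ≤ K := by
    refine Real.le_sqrt_of_sq_le ?_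
    have h1 : (2 : ℝ) ^ 3 ≤ (Fintype.card A : ℝ) ^ 3 :=
      pow_le_pow_left₀ (by norm_num) (by exact_mod_cast hA) 3
    have h2 : (1 : ℝ) ≤ (Fintype.card B : ℝ) ^ 3 := one_le_pow₀ (by exact_mod_cast hB)
    nlinarith
  have hKΔ : 0 < 2 * K / Δ + 1 := by positivity
  -- this `ε₀` keeps the trace distances in the range `[0, 1 / 2]` where the bound is monotone
  refine ⟨1 / (2 * K / Δ + 1), by positivity, fun ε hε hε₀ ρ' hρ' hdist => ?_⟩
  have hT : 1 / 2 * (2 * K / Δ + 1) * ε ≤ 1 / 2 := by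
    rw [le_div_iff₀ hKΔ] at hε₀
    linarith
  have h6 : (6 * ε / Δ + ε) / 2 ≤ 1 / 2 * (2 * K / Δ + 1) * ε := by
    have : 6 * ε / Δ ≤ 2 * K / Δ * ε := by
      rw [div_mul_eq_mul_div]
      gcongr
      linarith
    linarith
  have hgap : ∀ i j, i ≠ j →
      Δ ≤ |DiagonalDiscord.localSpectrum hρ i - DiagonalDiscord.localSpectrum hρ j| :=
    fun i j hij => hmin ⟨i, j, hij, rfl⟩
  have hmain := DiagonalDiscord.abs_diagonalDiscord_sub_le hρ hρ' hΔ hgap hε (by linarith)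
    ((DiagonalDiscord.hasTraceNormBound_traceNorm
      (hρ'.1.isHermitian.sub hρ.1.isHermitian)).mono hdist)
  have hmono := DiagonalDiscord.qaryEntropy_le_qaryEntropy
    (Fintype.card_pos (α := A × B)) (by positivity) h6 hT
  refine hmain.trans ((add_le_add_right hmono _).trans (le_of_eq ?_))
  simp only [Real.qaryEntropy, Fintype.card_prod]
  push_cast
  ring
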